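/- Let $n\ge 1$, let the weights $w_1,\dots,w_n$ and the capacity $C$ be positive integers, and consider the subset sum problem of maximizing $f(x)=\sum_{i=1}^n w_i x_i$ over $x\in\{0,1\}^n$ subject to $\sum_{i=1}^n w_i x_i\le C$. Put $W=\sum_{i=1}^n w_i$ and assume that $W>C$. A subproblem is given by a set $I\subseteq\{1,\dots,n\}$ of fixed indices and a map $\theta:I\to\{0,1\}$, meaning that $x_i=\theta(i)$ for $i\in I$ while the other variables are free. It satisfies the C0-condition if $\sum_{i\in I}\theta(i)w_i>C$, and the C1-condition if $\sum_{i\in I}(1-\theta(i))w_i\ge W-C$. The majoritarian Branch-and-Bound (MBnB) algorithm keeps a list of subproblems, which initially contains only the original problem ($I=\emptyset$), and an incumbent solution, initially $x=0$. In every iteration of its main loop it removes an arbitrary subproblem $P$ from the list. If $P$ satisfies the C0-condition, it is discarded. If $P$ satisfies the C1-condition, the tuple obtained by setting all its free variables to $1$ replaces the incumbent when its value of $f$ is larger. Otherwise $P$ is decomposed along a free variable $x_i$ of maximal weight (ties being broken arbitrarily): the two subproblems obtained by additionally fixing $x_i=0$ and $x_i=1$ are added to the list. The algorithm stops when the list is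 empty. The MBnB-tree is the rooted binary tree whose nodes are the processed subproblems, the children of a decomposed subproblem being the two subproblems of its decomposition. Let $w'_1\ge w'_2\ge\dots\ge w'_n$ be the weights sorted in non-increasing order and let $$t=\min\Bigl\{k\in\{1,\dots,n\}:\ \sum_{i=n-k+1}^n w'_i>C\Bigr\}.$$ Theorem. The algorithm always terminates, and the number $S$ of iterations of its main loop does not depend on the choices made and equals the number of nodes of every MBnB-tree of the problem (the MBnB complexity of the problem). It satisfies $$S\le 2\binom{n+1}{t}-1\quad\text{if } t\le\lfloor n/2\rfloor+1,$$ $$S\le 2\left(\binom{n+1}{\lfloor n/2\rfloor+1}-\binom{t}{\lfloor n/2\rfloor+1}\right)+1\quad\text{if } t>\lfloor n/2\rfloor+1.$$ -/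

import Mathlib

namespace MBnB

/-- A map `(I, θ)` on the variables `x_0, …, x_{n-1}`: `z i = some b` means that `i ∈ I` and
`θ i = b` (`true` stands for `1`), and `z i = none` means that `x_i` is free. A subproblem is
identified with its map. -/
abbrev PartialMap (n : ℕ) : Type := Fin n → Option Bool

variable {n : ℕ}

/-- The total weight of the variables of `z` that are fixed to the value `b`. -/
def fixedWeight (w : Fin n → ℕ) (b : Bool) (z : PartialMap n) : ℕ :=
  ∑ i with z i = some b, w i

/-- C0-condition: the variables fixed to `1` already exceed the capacity. -/
def CondZero (w : Fin n → ℕ) (C : ℕ) (z : PartialMap n) : Prop :=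
  C < fixedWeight w true z

/-- C1-condition: the variables fixed to `0` have total weight at least `W - C`, where `W` is the
sum of all weights. -/
def CondOne (w : Fin n → ℕ) (C : ℕ) (z : PartialMap n) : Prop :=
  (∑ i, (w i : ℤ)) - (C : ℤ) ≤ (fixedWeight w false z : ℤ)

/-- `i` is the index of a free variable of `z` with the maximal weight. -/
def IsMaxFree (w : Fin n → ℕ) (z : PartialMap n) (i : Fin n) : Prop :=
  z i = none ∧ ∀ j, z j = none → w j ≤ w i

/-- The subproblem in which the variable `x_i` is, in addition, fixed to `b`. -/
def fix (z : PartialMap n) (i : Fin n) (b : Bool) : PartialMap n :=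
  Function.update z i (some b)

/-- The objective function `f`. -/
def objective (w : Fin n → ℕ) (x : Fin n → Bool) : ℕ :=
  ∑ i with x i = true, w i

/-- The `1`-complement of a map: all free variables are set to `1`. -/
def oneComplement (z : PartialMap n) : Fin n → Bool :=
  fun i => (z i).getD true

/-- A state of the algorithm: the subproblems waiting for processing and the incumbent solution. -/
structure State (n : ℕ) where
  pending : Multiset (PartialMap n)
  incumbent : Fin n → Bool

/-- The initial state: only the original problem is waiting, and the incumbent is zero. -/
def initial (n : ℕ) : State n :=
  ⟨{fun _ => none}, fun _ => false⟩

/-- One iteration of the main loop, in which an arbitrary waiting subproblem `z` is selected. Ties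
between free variables of maximal weight may be broken in any way. -/
inductive Step (w : Fin n → ℕ) (C : ℕ) : State n → State n → Prop
  | discard (z : PartialMap n) (S : Multiset (PartialMap n)) (x : Fin n → Bool) :
      CondZero w C z → Step w C ⟨z ::ₘ S, x⟩ ⟨S, x⟩
  | solve (z : PartialMap n) (S : Multiset (PartialMap n)) (x : Fin n → Bool) :
      CondOne w C z →
      Step w C ⟨z ::ₘ S, x⟩
        ⟨S, if objective w x < objective w (oneComplement z) then oneComplement z else x⟩
  | branch (z : PartialMap n) (S : Multiset (PartialMap n)) (x : Fin n → Bool) (i : Fin n) :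
      ¬ CondZero w C z → ¬ CondOne w C z → IsMaxFree w z i →
      Step w C ⟨z ::ₘ S, x⟩ ⟨fix z i false ::ₘ fix z i true ::ₘ S, x⟩

/-- `Run w C k s`: the algorithm can be in state `s` after `k` iterations of the main loop. -/
inductive Run (w : Fin n → ℕ) (C : ℕ) : ℕ → State n → Prop
  | start : Run w C 0 (initial n)
  | next (k : ℕ) (s s' : State n) : Run w C k s → Step w C s s' → Run w C (k + 1) s'

/-- The MBnB complexity of the problem is `S`: the algorithm can terminate (with an empty list of
waiting subproblems), no execution performs more than `S` iterations of the main loop, and every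
execution that has terminated has performed exactly `S` of them. -/
def IsComplexity (w : Fin n → ℕ) (C : ℕ) (S : ℕ) : Prop :=
  (∃ s, Run w C S s ∧ s.pending = 0) ∧
    ∀ k s, Run w C k s → k ≤ S ∧ (s.pending = 0 → k = S)

/-- `IsTreeFrom w C z T`: `T` is a tree of subproblems that the algorithm generates from `z`. An
absent child is `BinaryTree.nil`, so that `BinaryTree.numNodes` counts all subproblems in `T`. -/
inductive IsTreeFrom (w : Fin n → ℕ) (C : ℕ) :
    PartialMap n → BinaryTree (PartialMap n) → Prop
  | leaf (z : PartialMap n) : CondZero w C z ∨ CondOne w C z →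
      IsTreeFrom w C z (.node z .nil .nil)
  | split (z : PartialMap n) (i : Fin n) (L R : BinaryTree (PartialMap n)) :
      ¬ CondZero w C z → ¬ CondOne w C z → IsMaxFree w z i →
      IsTreeFrom w C (fix z i false) L → IsTreeFrom w C (fix z i true) R →
      IsTreeFrom w C z (.node z L R)

/-- `T` is an MBnB-tree of the problem; its root is the original problem. -/
def IsMBnBTree (w : Fin n → ℕ) (C : ℕ) (T : BinaryTree (PartialMap n)) : Prop :=
  IsTreeFrom w C (fun _ => none) T

end MBnB

/-! The leaves of every tree correspond to minimal covers and maximal feasible sets. Branching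
always fixes a heaviest free variable, so the last fixed variable is a lightest fixed one. Hence at
a C0-leaf the ones form a minimal cover, at a C1-leaf the variables not fixed to 0 form a maximal
feasible set, and no other set of either kind agrees with the leaf (`numLeaves_of_condZero`,
`numLeaves_of_condOne`). A decomposition splits the compatible sets between the two children, so the
number `L` of leaves is independent of all choices. Every tree has `2 * L - 1` nodes, and every
terminated run has as many iterations.

It remains to bound `L`. Adding one new element to each maximal feasible set turns the two families
into a single antichain in a set of `n + 1` elements (`isAntichain_leafFamily`). Every set of `t`
variables is a cover, so its members have size at most `t`, and the LYM inequality gives the first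
bound. For larger `t`, the `t - 1` lightest variables form a maximal feasible set; with the new
element it is a member of size `t` that contains no other member. The other members can be shifted
to the middle level without loss while avoiding its subsets (`card_le_of_antichain_not_subset`),
which gives the second bound. -/

/-! ### Antichains avoiding the subsets of a given set -/

namespace Finset

variable {α : Type*} [Fintype α]

/-- An antichain of sets of size at most `t` has at most `(card α).choose t` elements, when the
binomial coefficients are monotone up to `t`. -/
theorem card_le_choose_of_antichain {𝒜 : Finset (Finset α)} {t : ℕ}
    (anti : IsAntichain (· ⊆ ·) (𝒜 : Set (Finset α))) (hsize : ∀ A ∈ 𝒜, #A ≤ t)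
    (ht : 2 * t ≤ Fintype.card α + 1) (ht' : t ≤ Fintype.card α) :
    #𝒜 ≤ (Fintype.card α).choose t := by
  set N := Fintype.card α
  have mono : ∀ r ≤ t, N.choose r ≤ N.choose t := by
    refine fun r hr => Nat.decreasingInduction' (n := t) (m := r)
      (P := fun r => N.choose r ≤ N.choose t) (fun k hk _ ih => le_trans ?_ ih) hr le_rfl
    -- The ratio of consecutive coefficients is `(N - k) / (k + 1)`, at least 1 because `k < t` and
    -- `2 * t ≤ N + 1`.
    refine Nat.le_of_mul_le_mul_right (c := k + 1) ?_ k.succ_pos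
    rw [Nat.choose_succ_right_eq]
    exact Nat.mul_le_mul_left _ (by omega)
  have pos : 0 < N.choose t := Nat.choose_pos ht'
  have lym := lubell_yamamoto_meshalkin_inequality_sum_inv_choose (𝕜 := ℚ) anti
  have : (#𝒜 : ℚ) * (N.choose t : ℚ)⁻¹ ≤ 1 := by
    refine le_trans ?_ lym
    rw [← nsmul_eq_mul]
    refine card_nsmul_le_sum _ _ _ fun A hA => ?_
    have := mono _ (hsize A hA)
    have : 0 < N.choose #A := Nat.choose_pos (card_le_univ A)
    gcongr
  rw [mul_inv_le_iff₀ (by exact_mod_cast pos), one_mul] at this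
  exact_mod_cast this

variable [DecidableEq α]

/-- In an antichain of sets not contained in `K`, the sets of size `k + 1` can be replaced with
their subsets of size `k` that are not contained in `K`, when `k` is at least half of the size of
the ground set. -/
theorem exists_antichain_push_down {K : Finset α} {𝒜 : Finset (Finset α)} {h k : ℕ}
    (anti : IsAntichain (· ⊆ ·) (𝒜 : Set (Finset α))) (hK : ∀ A ∈ 𝒜, ¬ A ⊆ K)
    (hsize : ∀ A ∈ 𝒜, h ≤ #A ∧ #A ≤ k + 1) (hhk : h ≤ k) (hk0 : 0 < k)
    (hk : Fintype.card α ≤ 2 * k) :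
    ∃ ℬ : Finset (Finset α), IsAntichain (· ⊆ ·) (ℬ : Set (Finset α)) ∧
      (∀ B ∈ ℬ, ¬ B ⊆ K) ∧ (∀ B ∈ ℬ, h ≤ #B ∧ #B ≤ k) ∧ #𝒜 ≤ #ℬ := by
  set top := {A ∈ 𝒜 | #A = k + 1} with htop
  set low := {A ∈ 𝒜 | #A ≠ k + 1} with hlow
  set sh : Finset (Finset α) := {B | ¬ B ⊆ K ∧ #B = k ∧ ∃ A ∈ top, B ⊆ A} with hsh
  have hlow_le : ∀ A ∈ low, #A ≤ k := fun A hA => by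
    rw [hlow, mem_filter] at hA
    have := hsize A hA.1
    omega
  have hnot : ∀ A ∈ 𝒜, ∀ B ∈ sh, ¬ A ⊆ B := fun A hA B hB hAB => by
    simp only [hsh, htop, mem_filter, mem_univ, true_and] at hB
    obtain ⟨-, hBk, T, ⟨hT, hTk⟩, hBT⟩ := hB
    have := anti.eq hA hT (hAB.trans hBT)
    have := card_le_card hAB
    grind
  have hdisj : Disjoint low sh := disjoint_left.2 fun A hA hA' =>
    hnot A (mem_filter.1 hA).1 A hA' Subset.rfl
  have hcard : #top ≤ #sh := by
    -- Double counting: each top set has at least `k` neighbours in `sh`, and each set in `sh` has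
    -- at most `card α - k ≤ k` top neighbours. To stay outside `K`, keep one point `x ∉ K` and
    -- erase any of the other `k` points.
    refine Nat.le_of_mul_le_mul_right (c := k) ?_ hk0
    refine card_mul_le_card_mul (fun A B => B ⊆ A) (fun A hA => ?_) (fun B hB => ?_)
    · obtain ⟨hA𝒜, hAk⟩ := mem_filter.1 hA
      obtain ⟨x, hxA, hxK⟩ := not_subset.1 (hK A hA𝒜)
      calc k = #((A.erase x).image A.erase) := by
            rw [card_image_of_injOn (A.erase_injOn.mono (by simp)),
              card_erase_of_mem hxA, hAk, Nat.add_sub_cancel]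
        _ ≤ _ := card_le_card fun B hB => by
            obtain ⟨a, ha, rfl⟩ := mem_image.1 hB
            obtain ⟨hax, haA⟩ := mem_erase.1 ha
            simp only [mem_bipartiteAbove, hsh, mem_filter, mem_univ, true_and]
            refine ⟨⟨fun hs => hxK (hs (mem_erase.2 ⟨hax.symm, hxA⟩)), ?_, A, hA,
              erase_subset _ _⟩, erase_subset _ _⟩
            rw [card_erase_of_mem haA, hAk, Nat.add_sub_cancel]
    · simp only [hsh, mem_filter, mem_univ, true_and] at hB
      calc #(top.bipartiteBelow (fun A B => B ⊆ A) B) ≤ #(Bᶜ.image fun a => insert a B) :=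
            card_le_card fun A hA => by
              obtain ⟨hA, hBA⟩ := (mem_bipartiteBelow _).1 hA
              obtain ⟨a, ha, rfl⟩ := exists_eq_insert_iff.2 ⟨hBA, by
                rw [hB.2.1, (mem_filter.1 hA).2]⟩
              exact mem_image.2 ⟨a, mem_compl.2 ha, rfl⟩
        _ ≤ #Bᶜ := card_image_le
        _ ≤ k := by rw [card_compl]; omega
  refine ⟨low ∪ sh, ?_, ?_, ?_, ?_⟩
  · intro A hA B hB hne hAB
    simp only [coe_union, Set.mem_union, mem_coe] at hA hB
    rcases hA with hA | hA <;> rcases hB with hB | hB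
    · exact anti (mem_filter.1 hA).1 (mem_filter.1 hB).1 hne hAB
    · exact hnot A (mem_filter.1 hA).1 B hB hAB
    · have hAk := (mem_filter.1 hA).2.2.1
      exact hne (eq_of_subset_of_card_le hAB (hAk ▸ hlow_le B hB))
    · have hAk := (mem_filter.1 hA).2.2.1
      have hBk := (mem_filter.1 hB).2.2.1
      exact hne (eq_of_subset_of_card_le hAB (by omega))
  · intro B hB
    rcases mem_union.1 hB with hB | hB
    · exact hK B (mem_filter.1 hB).1
    · exact (mem_filter.1 hB).2.1
  · intro B hB
    rcases mem_union.1 hB with hB | hB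
    · exact ⟨(hsize B (mem_filter.1 hB).1).1, hlow_le B hB⟩
    · have := (mem_filter.1 hB).2.2.1
      omega
  · have hsum : #top + #low = #𝒜 := card_filter_add_card_filter_not (s := 𝒜) (#· = k + 1)
    rw [card_union_of_disjoint hdisj]
    omega

/-- In an antichain of sets not contained in `K`, the sets of size `k` can be replaced with their
supersets of size `k + 1`, when `k` is less than half of the size of the ground set. -/
theorem exists_antichain_push_up {K : Finset α} {𝒜 : Finset (Finset α)} {k : ℕ}
    (anti : IsAntichain (· ⊆ ·) (𝒜 : Set (Finset α))) (hK : ∀ A ∈ 𝒜, ¬ A ⊆ K)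
    (hsize : ∀ A ∈ 𝒜, k ≤ #A) (hk : 2 * k + 1 ≤ Fintype.card α) :
    ∃ ℬ : Finset (Finset α), IsAntichain (· ⊆ ·) (ℬ : Set (Finset α)) ∧
      (∀ B ∈ ℬ, ¬ B ⊆ K) ∧ (∀ B ∈ ℬ, k + 1 ≤ #B) ∧ #𝒜 ≤ #ℬ := by
  set bot := {A ∈ 𝒜 | #A = k} with hbot
  set high := {A ∈ 𝒜 | #A ≠ k} with hhigh
  set sh : Finset (Finset α) := {B | #B = k + 1 ∧ ∃ A ∈ bot, A ⊆ B} with hsh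
  have hhigh_le : ∀ A ∈ high, k + 1 ≤ #A := fun A hA => by
    rw [hhigh, mem_filter] at hA
    have := hsize A hA.1
    omega
  have hnot : ∀ A ∈ 𝒜, ∀ B ∈ sh, ¬ B ⊆ A := fun A hA B hB hAB => by
    simp only [hsh, hbot, mem_filter, mem_univ, true_and] at hB
    obtain ⟨hBk, T, ⟨hT, hTk⟩, hBT⟩ := hB
    have := anti.eq hT hA (hBT.trans hAB)
    have := card_le_card hAB
    grind
  have hdisj : Disjoint high sh := disjoint_left.2 fun A hA hA' =>
    hnot A (mem_filter.1 hA).1 A hA' Subset.rfl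
  have hcard : #bot ≤ #sh := by
    -- Double counting again, with `card α - k ≥ k + 1` supersets for each bottom set. Supersets
    -- avoid being inside `K` automatically.
    refine Nat.le_of_mul_le_mul_right (c := k + 1) ?_ k.succ_pos
    refine card_mul_le_card_mul (fun A B => A ⊆ B) (fun A hA => ?_) (fun B hB => ?_)
    · obtain ⟨hA𝒜, hAk⟩ := mem_filter.1 hA
      calc k + 1 ≤ #Aᶜ := by rw [card_compl]; omega
        _ = #(Aᶜ.image fun a => insert a A) := by
            rw [card_image_of_injOn]
            intro a ha b hb hab
            exact (insert_inj (by simpa using ha)).1 hab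
        _ ≤ _ := card_le_card fun B hB => by
            obtain ⟨a, ha, rfl⟩ := mem_image.1 hB
            simp only [mem_bipartiteAbove, hsh, mem_filter, mem_univ, true_and]
            refine ⟨⟨?_, A, hA, subset_insert _ _⟩, subset_insert _ _⟩
            rw [card_insert_of_notMem (mem_compl.1 ha), hAk]
    · simp only [hsh, mem_filter, mem_univ, true_and] at hB
      calc #(bot.bipartiteBelow (fun A B => A ⊆ B) B) ≤ #(B.image B.erase) :=
            card_le_card fun A hA => by
              obtain ⟨hA, hAB⟩ := (mem_bipartiteBelow _).1 hA
              obtain ⟨a, ha, rfl⟩ := exists_eq_insert_iff.2 ⟨hAB, by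
                rw [hB.1, (mem_filter.1 hA).2]⟩
              exact mem_image.2 ⟨a, mem_insert_self _ _, erase_insert ha⟩
        _ ≤ #B := card_image_le
        _ ≤ k + 1 := hB.1.le
  refine ⟨high ∪ sh, ?_, ?_, ?_, ?_⟩
  · intro A hA B hB hne hAB
    simp only [coe_union, Set.mem_union, mem_coe] at hA hB
    rcases hA with hA | hA <;> rcases hB with hB | hB
    · exact anti (mem_filter.1 hA).1 (mem_filter.1 hB).1 hne hAB
    · have hBk := (mem_filter.1 hB).2.1
      exact hne (eq_of_subset_of_card_le hAB (hBk ▸ hhigh_le A hA))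
    · exact hnot B (mem_filter.1 hB).1 A hA hAB
    · have hAk := (mem_filter.1 hA).2.1
      have hBk := (mem_filter.1 hB).2.1
      exact hne (eq_of_subset_of_card_le hAB (by omega))
  · intro B hB hBK
    rcases mem_union.1 hB with hB | hB
    · exact hK B (mem_filter.1 hB).1 hBK
    · obtain ⟨A, hA, hAB⟩ := (mem_filter.1 hB).2.2
      exact hK A (mem_filter.1 hA).1 (hAB.trans hBK)
  · intro B hB
    rcases mem_union.1 hB with hB | hB
    · exact hhigh_le B hB
    · exact (mem_filter.1 hB).2.1.ge
  · have hsum : #bot + #high = #𝒜 := card_filter_add_card_filter_not (s := 𝒜) (#· = k)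
    rw [card_union_of_disjoint hdisj]
    omega

/-- An antichain of sets that are not contained in `K` is not larger than the family of the sets of
size `h` not contained in `K`, when `h` is half of the size of the ground set, rounded up. -/
theorem card_le_of_antichain_not_subset {K : Finset α} {𝒜 : Finset (Finset α)} {h : ℕ}
    (anti : IsAntichain (· ⊆ ·) (𝒜 : Set (Finset α))) (hK : ∀ A ∈ 𝒜, ¬ A ⊆ K)
    (h0 : 0 < h) (hle : Fintype.card α ≤ 2 * h) (hge : 2 * h ≤ Fintype.card α + 1) :
    #𝒜 ≤ (Fintype.card α).choose h - (#K).choose h := by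
  have up : ∀ k ≤ h, ∃ ℬ : Finset (Finset α), IsAntichain (· ⊆ ·) (ℬ : Set (Finset α)) ∧
      (∀ B ∈ ℬ, ¬ B ⊆ K) ∧ (∀ B ∈ ℬ, k ≤ #B) ∧ #𝒜 ≤ #ℬ := by
    intro k hk
    induction k with
    | zero => exact ⟨𝒜, anti, hK, by simp, le_rfl⟩
    | succ k ih =>
      obtain ⟨ℬ, h1, h2, h3, h4⟩ := ih (by omega)
      obtain ⟨𝒞, h5, h6, h7, h8⟩ := exists_antichain_push_up h1 h2 h3 (by omega)
      exact ⟨𝒞, h5, h6, h7, h4.trans h8⟩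
  have down : ∀ d, ∀ ℬ : Finset (Finset α), IsAntichain (· ⊆ ·) (ℬ : Set (Finset α)) →
      (∀ B ∈ ℬ, ¬ B ⊆ K) → (∀ B ∈ ℬ, h ≤ #B ∧ #B ≤ h + d) →
      #ℬ ≤ (Fintype.card α).choose h - (#K).choose h := by
    intro d
    induction d with
    | zero =>
      intro ℬ _ h2 h3
      rw [← card_univ, ← card_powersetCard, ← card_powersetCard h K,
        ← card_sdiff_of_subset (powersetCard_mono (subset_univ K))]
      refine card_le_card fun B hB => ?_
      have := h3 B hB
      simp only [mem_sdiff, mem_powersetCard, subset_univ, true_and]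
      exact ⟨by omega, fun hb => h2 B hB hb.1⟩
    | succ d ih =>
      intro ℬ h1 h2 h3
      obtain ⟨𝒞, h5, h6, h7, h8⟩ :=
        exists_antichain_push_down (k := h + d) h1 h2 h3 (by omega) (by omega) (by omega)
      exact h8.trans (ih 𝒞 h5 h6 h7)
  obtain ⟨ℬ, h1, h2, h3, h4⟩ := up h le_rfl
  -- The number of downward steps only has to be large enough; `card α` always suffices.
  refine h4.trans (down (Fintype.card α) ℬ h1 h2 fun B hB => ⟨h3 B hB, ?_⟩)
  exact (card_le_univ B).trans (Nat.le_add_left _ _)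

end Finset

namespace MBnB

open Finset

/-! ### Minimal covers and maximal feasible sets -/

variable {n : ℕ}

/-- The minimal covers: the minimal sets whose weight exceeds the capacity. -/
def minCovers (w : Fin n → ℕ) (C : ℕ) : Finset (Finset (Fin n)) :=
  {A | C < ∑ i ∈ A, w i ∧ ∀ a ∈ A, ∑ i ∈ A, w i ≤ C + w a}

/-- The maximal feasible sets: the maximal sets whose weight does not exceed the capacity. -/
def maxFeasible (w : Fin n → ℕ) (C : ℕ) : Finset (Finset (Fin n)) :=
  {B | ∑ i ∈ B, w i ≤ C ∧ ∀ a ∉ B, C < ∑ i ∈ B, w i + w a}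

/-- The set `A` agrees with the fixed variables of `z`. -/
def Compat (z : PartialMap n) (A : Finset (Fin n)) : Prop :=
  ∀ i b, z i = some b → (i ∈ A ↔ b = true)

open Classical in
/-- The number of the sets in `ℱ` that agree with the fixed variables of `z`. -/
noncomputable def numCompat (ℱ : Finset (Finset (Fin n))) (z : PartialMap n) : ℕ :=
  #{A ∈ ℱ | Compat z A}

/-- The number of leaves of the trees that the algorithm generates from `z`. -/
noncomputable def numLeaves (w : Fin n → ℕ) (C : ℕ) (z : PartialMap n) : ℕ :=
  numCompat (minCovers w C) z + numCompat (maxFeasible w C) z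

/-- The properties of the subproblems generated by the algorithm: the free variables are the
lightest ones, and neither condition holds before the last decomposition. -/
structure Reachable (w : Fin n → ℕ) (C : ℕ) (z : PartialMap n) : Prop where
  le_of_free : ∀ i j b, z i = some b → z j = none → w j ≤ w i
  ones_le : ∀ i, z i = some true → fixedWeight w true z ≤ C + w i
  zeros_lt : ∀ i, z i = some false → fixedWeight w false z + C < ∑ j, w j + w i

variable {w : Fin n → ℕ} {C : ℕ} {z : PartialMap n}

theorem reachable_root (w : Fin n → ℕ) (C : ℕ) : Reachable w C fun _ => none :=
  ⟨by simp, by simp, by simp⟩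

theorem condOne_iff : CondOne w C z ↔ ∑ i, w i ≤ fixedWeight w false z + C := by
  rw [CondOne, ← Nat.cast_sum]
  omega

theorem fixedWeight_fix_self {i : Fin n} (hi : z i = none) (b : Bool) :
    fixedWeight w b (fix z i b) = fixedWeight w b z + w i := by
  have : univ.filter (fun j => fix z i b j = some b) =
      insert i (univ.filter fun j => z j = some b) := by
    ext j
    by_cases h : j = i <;> simp [fix, Function.update_apply, h]
  rw [fixedWeight, this, sum_insert (by simp [hi]), add_comm, fixedWeight]

theorem fixedWeight_fix_of_ne {i : Fin n} (hi : z i = none) {b c : Bool} (hbc : c ≠ b) :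
    fixedWeight w c (fix z i b) = fixedWeight w c z := by
  refine sum_congr (filter_congr fun j _ => ?_) fun _ _ => rfl
  by_cases h : j = i <;> simp [fix, h, hi, hbc.symm]

/-- The new variable is a lightest fixed one, so the bounds that the parent's failed conditions give
for its weight hold for the weight of every fixed variable. -/
theorem Reachable.fix (hz : Reachable w C z) (h0 : ¬ CondZero w C z) (h1 : ¬ CondOne w C z)
    {i : Fin n} (hi : IsMaxFree w z i) (b : Bool) : Reachable w C (fix z i b) := by
  rw [CondZero, not_lt] at h0
  rw [condOne_iff, not_le] at h1
  have hval : ∀ j c, MBnB.fix z i b j = some c → (j = i ∧ c = b) ∨ z j = some c := by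
    intro j c hj
    by_cases h : j = i
    · simp only [MBnB.fix, h, Function.update_self, Option.some.injEq] at hj
      exact .inl ⟨h, hj.symm⟩
    · simpa [MBnB.fix, h] using hj
  have hle : ∀ j c, MBnB.fix z i b j = some c → w i ≤ w j := by
    intro j c hj
    rcases hval j c hj with ⟨rfl, -⟩ | h
    · exact le_rfl
    · exact hz.le_of_free j i c h hi.1
  refine ⟨fun j k c hj hk => ?_, fun j hj => ?_, fun j hj => ?_⟩
  · have hk' : z k = none := by
      by_cases h : k = i
      · simp [MBnB.fix, h] at hk
      · simpa [MBnB.fix, h] using hk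
    exact (hi.2 k hk').trans (hle j c hj)
  · have := hle j _ hj
    cases b
    · rw [fixedWeight_fix_of_ne hi.1 (by simp)]
      omega
    · rw [fixedWeight_fix_self hi.1]
      omega
  · have := hle j _ hj
    cases b
    · rw [fixedWeight_fix_self hi.1]
      omega
    · rw [fixedWeight_fix_of_ne hi.1 (by simp)]
      omega

/-! ### The number of leaves -/

theorem compat_fix_iff {i : Fin n} (hi : z i = none) (b : Bool) (A : Finset (Fin n)) :
    Compat (fix z i b) A ↔ Compat z A ∧ (i ∈ A ↔ b = true) := by
  constructor
  · intro h
    refine ⟨fun j c hj => h j c ?_, h i b (by simp [fix])⟩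
    have : j ≠ i := by rintro rfl; simp [hi] at hj
    simpa [fix, this] using hj
  · rintro ⟨h, hb⟩ j c hj
    by_cases hji : j = i
    · subst hji
      simp only [fix, Function.update_self, Option.some.injEq] at hj
      exact hj ▸ hb
    · exact h j c (by simpa [fix, hji] using hj)

theorem numCompat_fix_add (ℱ : Finset (Finset (Fin n))) {i : Fin n} (hi : z i = none) :
    numCompat ℱ (fix z i false) + numCompat ℱ (fix z i true) = numCompat ℱ z := by
  classical
  simp only [numCompat, compat_fix_iff hi, ← filter_filter, iff_true, Bool.false_eq_true, iff_false]
  rw [add_comm]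
  exact card_filter_add_card_filter_not _

theorem numLeaves_fix_add {i : Fin n} (hi : z i = none) :
    numLeaves w C (fix z i false) + numLeaves w C (fix z i true) = numLeaves w C z := by
  have h0 := numCompat_fix_add (minCovers w C) hi
  have h1 := numCompat_fix_add (maxFeasible w C) hi
  simp only [numLeaves]
  omega

theorem numCompat_eq_one {ℱ : Finset (Finset (Fin n))} {A : Finset (Fin n)} (hA : A ∈ ℱ)
    (hz : Compat z A) (h : ∀ B ∈ ℱ, Compat z B → B = A) : numCompat ℱ z = 1 := by
  classical
  rw [numCompat, card_eq_one]
  exact ⟨A, eq_singleton_iff_unique_mem.2 ⟨by simp [hA, hz], by simpa using h⟩⟩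

theorem numCompat_eq_zero {ℱ : Finset (Finset (Fin n))} (h : ∀ B ∈ ℱ, ¬ Compat z B) :
    numCompat ℱ z = 0 := by
  classical
  rw [numCompat, card_eq_zero, filter_eq_empty_iff]
  exact fun B hB => h B hB

theorem sum_add_le_of_ssubset {A B : Finset (Fin n)} (h : A ⊂ B) :
    ∃ b ∈ B, b ∉ A ∧ ∑ i ∈ A, w i + w b ≤ ∑ i ∈ B, w i := by
  obtain ⟨b, hb, hbA⟩ := exists_of_ssubset h
  refine ⟨b, hb, hbA, ?_⟩
  rw [add_comm, ← sum_insert hbA]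
  exact sum_le_sum_of_subset (insert_subset hb h.1)

theorem minCovers_eq_of_subset {A B : Finset (Fin n)} (hA : C < ∑ i ∈ A, w i)
    (hB : B ∈ minCovers w C) (h : A ⊆ B) : A = B := by
  by_contra hne
  obtain ⟨b, hb, -, hle⟩ := sum_add_le_of_ssubset (w := w) (h.ssubset_of_ne hne)
  have := (mem_filter.1 hB).2.2 b hb
  omega

theorem maxFeasible_eq_of_subset {A B : Finset (Fin n)} (hA : A ∈ maxFeasible w C)
    (hB : ∑ i ∈ B, w i ≤ C) (h : A ⊆ B) : A = B := by
  by_contra hne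
  obtain ⟨b, -, hb, hle⟩ := sum_add_le_of_ssubset (w := w) (h.ssubset_of_ne hne)
  have := (mem_filter.1 hA).2.2 b hb
  omega

theorem sum_lt_of_mem_minCovers {A : Finset (Fin n)} (h : A ∈ minCovers w C) :
    C < ∑ i ∈ A, w i :=
  (mem_filter.1 h).2.1

theorem sum_le_of_mem_maxFeasible {A : Finset (Fin n)} (h : A ∈ maxFeasible w C) :
    ∑ i ∈ A, w i ≤ C :=
  (mem_filter.1 h).2.1

/-- Every compatible set contains the set of ones, which is already a cover. So none is feasible,
and a compatible minimal cover must equal the set of ones, which is minimal by `ones_le`. -/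
theorem numLeaves_of_condZero (hz : Reachable w C z) (h : CondZero w C z) :
    numLeaves w C z = 1 := by
  have hsub : ∀ B, Compat z B → univ.filter (fun i => z i = some true) ⊆ B := fun B hB i hi =>
    (hB i true (mem_filter.1 hi).2).2 rfl
  rw [numLeaves, numCompat_eq_zero (ℱ := maxFeasible w C), add_zero]
  · refine numCompat_eq_one (A := univ.filter fun i => z i = some true) ?_ ?_ ?_
    · exact mem_filter.2 ⟨mem_univ _, h, fun a ha => hz.ones_le a (mem_filter.1 ha).2⟩
    · intro i b hi
      simp [hi]
    · exact fun B hB hzB => (minCovers_eq_of_subset h hB (hsub B hzB)).symm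
  · intro B hB hzB
    have := sum_le_of_mem_maxFeasible hB
    have := sum_le_sum_of_subset (f := w) (hsub B hzB)
    have : C < ∑ i with z i = some true, w i := h
    omega

/-- Dual argument: every compatible set lies in the complement of the zeros, which is feasible, and
maximal by `zeros_lt`. -/
theorem numLeaves_of_condOne (hz : Reachable w C z) (h : CondOne w C z) :
    numLeaves w C z = 1 := by
  have hsub : ∀ B, Compat z B → B ⊆ univ.filter (fun i => ¬ z i = some false) := fun B hB i hi =>
    mem_filter.2 ⟨mem_univ _, fun h => by simpa using (hB i false h).1 hi⟩
  have hsum : fixedWeight w false z + ∑ i with ¬ z i = some false, w i = ∑ i, w i :=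
    sum_filter_add_sum_filter_not _ _ _
  rw [condOne_iff] at h
  rw [numLeaves, numCompat_eq_zero (ℱ := minCovers w C), zero_add]
  · refine numCompat_eq_one (A := univ.filter fun i => ¬ z i = some false) ?_ ?_ ?_
    · refine mem_filter.2 ⟨mem_univ _, by omega, fun a ha => ?_⟩
      have := hz.zeros_lt a (by simpa using ha)
      omega
    · intro i b hi
      simp [hi]
    · exact fun B hB hzB => maxFeasible_eq_of_subset hB (by omega) (hsub B hzB)
  · intro B hB hzB
    have := sum_lt_of_mem_minCovers hB
    have := sum_le_sum_of_subset (f := w) (hsub B hzB)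
    omega

/-! ### The trees -/

theorem numNodes_add_one {T : BinaryTree (PartialMap n)} (hT : IsTreeFrom w C z T)
    (hz : Reachable w C z) : T.numNodes + 1 = 2 * numLeaves w C z := by
  induction hT with
  | leaf z h =>
    have : numLeaves w C z = 1 := h.elim (numLeaves_of_condZero hz) (numLeaves_of_condOne hz)
    simp [BinaryTree.numNodes, this]
  | split z i L R h0 h1 hi _ _ ihL ihR =>
    have hL := ihL (hz.fix h0 h1 hi false)
    have hR := ihR (hz.fix h0 h1 hi true)
    have := numLeaves_fix_add (w := w) (C := C) hi.1
    simp only [BinaryTree.numNodes]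
    omega

/-- Without free variables the ones and zeros together weigh the total, which forces one of the two
conditions. -/
theorem exists_isMaxFree (h0 : ¬ CondZero w C z) (h1 : ¬ CondOne w C z) :
    ∃ i, IsMaxFree w z i := by
  have hne : (univ.filter fun i => z i = none).Nonempty := by
    by_contra hne
    rw [not_nonempty_iff_eq_empty, filter_eq_empty_iff] at hne
    have hsum : fixedWeight w false z + ∑ i with ¬ z i = some false, w i = ∑ i, w i :=
      sum_filter_add_sum_filter_not _ _ _
    have : ∑ i with ¬ z i = some false, w i = fixedWeight w true z := by
      refine sum_congr (filter_congr fun i _ => ?_) fun _ _ => rfl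
      have := hne (mem_univ i)
      rcases hzi : z i with _ | _ | _ <;> simp_all
    rw [CondZero] at h0
    rw [condOne_iff] at h1
    omega
  obtain ⟨i, hi, hmax⟩ := exists_max_image _ w hne
  exact ⟨i, (mem_filter.1 hi).2, fun j hj => hmax j (by simp [hj])⟩

theorem card_free_fix_lt {i : Fin n} (hi : z i = none) (b : Bool) :
    #{j | fix z i b j = none} < #{j | z j = none} := by
  have hsub : univ.filter (fun j => fix z i b j = none) ⊆ univ.filter (fun j => z j = none) := by
    intro j hj
    rw [mem_filter] at hj ⊢
    by_cases h : j = i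
    · simp [h, fix] at hj
    · simpa [fix, h] using hj
  refine card_lt_card (ssubset_of_subset_of_ne hsub fun h => ?_)
  have : i ∈ univ.filter fun j => fix z i b j = none := h ▸ by simp [hi]
  simpa [fix] using (mem_filter.1 this).2

theorem exists_isTreeFrom (w : Fin n → ℕ) (C : ℕ) (z : PartialMap n) :
    ∃ T, IsTreeFrom w C z T := by
  induction hk : #{j | z j = none} using Nat.strong_induction_on generalizing z with
  | _ k ih =>
    by_cases h : CondZero w C z ∨ CondOne w C z
    · exact ⟨_, .leaf z h⟩
    · obtain ⟨h0, h1⟩ := not_or.1 h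
      obtain ⟨i, hi⟩ := exists_isMaxFree h0 h1
      obtain ⟨L, hL⟩ := ih _ (hk ▸ card_free_fix_lt hi.1 false) _ rfl
      obtain ⟨R, hR⟩ := ih _ (hk ▸ card_free_fix_lt hi.1 true) _ rfl
      exact ⟨_, .split z i L R h0 h1 hi hL hR⟩

theorem numLeaves_pos (hz : Reachable w C z) : 0 < numLeaves w C z := by
  obtain ⟨T, hT⟩ := exists_isTreeFrom w C z
  have := numNodes_add_one hT hz
  omega

/-! ### The executions of the algorithm -/

/-- The number of iterations that are needed to process all waiting subproblems. -/
noncomputable def remaining (w : Fin n → ℕ) (C : ℕ) (s : State n) : ℕ :=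
  (s.pending.map fun z => 2 * numLeaves w C z - 1).sum

/-- A leaf costs 1. For a decomposition, `2 * (a + b) - 1 = 1 + (2 * a - 1) + (2 * b - 1)`, where
positivity of `a` and `b` keeps the truncated subtraction harmless. -/
theorem remaining_step {s s' : State n} (h : Step w C s s')
    (hs : ∀ z ∈ s.pending, Reachable w C z) :
    remaining w C s = remaining w C s' + 1 ∧ ∀ z ∈ s'.pending, Reachable w C z := by
  cases h with
  | discard z S x h =>
    have hz := hs z (Multiset.mem_cons_self _ _)
    refine ⟨?_, fun y hy => hs y (Multiset.mem_cons_of_mem hy)⟩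
    simp [remaining, numLeaves_of_condZero hz h, add_comm]
  | solve z S x h =>
    have hz := hs z (Multiset.mem_cons_self _ _)
    refine ⟨?_, fun y hy => hs y (Multiset.mem_cons_of_mem hy)⟩
    simp [remaining, numLeaves_of_condOne hz h, add_comm]
  | branch z S x i h0 h1 hi =>
    have hz := hs z (Multiset.mem_cons_self _ _)
    have h := numLeaves_fix_add (w := w) (C := C) hi.1
    have hf := numLeaves_pos (hz.fix h0 h1 hi false)
    have ht := numLeaves_pos (hz.fix h0 h1 hi true)
    refine ⟨?_, fun y hy => ?_⟩
    · simp only [remaining, Multiset.map_cons, Multiset.sum_cons]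
      omega
    · rcases Multiset.mem_cons.1 hy with rfl | hy
      · exact hz.fix h0 h1 hi false
      rcases Multiset.mem_cons.1 hy with rfl | hy
      · exact hz.fix h0 h1 hi true
      · exact hs y (Multiset.mem_cons_of_mem hy)

theorem add_remaining_of_run {k : ℕ} {s : State n} (h : Run w C k s) :
    k + remaining w C s = 2 * numLeaves w C (fun _ => none) - 1 ∧
      ∀ z ∈ s.pending, Reachable w C z := by
  induction h with
  | start => simp [remaining, initial, reachable_root]
  | next k s s' _ hstep ih =>
    have := remaining_step hstep ih.2
    exact ⟨by omega, this.2⟩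

theorem exists_step {s : State n} (hs : s.pending ≠ 0) : ∃ s', Step w C s s' := by
  obtain ⟨P, x⟩ := s
  obtain ⟨z, hz⟩ := Multiset.exists_mem_of_ne_zero hs
  obtain ⟨S, rfl⟩ := Multiset.exists_cons_of_mem hz
  by_cases h0 : CondZero w C z
  · exact ⟨_, .discard z S x h0⟩
  by_cases h1 : CondOne w C z
  · exact ⟨_, .solve z S x h1⟩
  obtain ⟨i, hi⟩ := exists_isMaxFree h0 h1
  exact ⟨_, .branch z S x i h0 h1 hi⟩

theorem isComplexity (w : Fin n → ℕ) (C : ℕ) :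
    IsComplexity w C (2 * numLeaves w C (fun _ => none) - 1) := by
  have final : ∀ k s, Run w C k s → s.pending = 0 →
      k = 2 * numLeaves w C (fun _ => none) - 1 := fun k s h h0 => by
    have := (add_remaining_of_run h).1
    simpa [remaining, h0] using this
  refine ⟨?_, fun k s h => ⟨?_, final k s h⟩⟩
  -- If no run stopped after the predicted number of iterations, none would stop at all, and a run
  -- could be prolonged past the bound.
  · by_contra hno
    have : ∀ k, ∃ s, Run w C k s := by
      intro k
      induction k with
      | zero => exact ⟨_, .start⟩
      | succ k ih =>
        obtain ⟨s, hs⟩ := ih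
        obtain ⟨s', hs'⟩ := exists_step (w := w) (C := C) (s := s) fun h0 =>
          hno ⟨s, final k s hs h0 ▸ hs, h0⟩
        exact ⟨s', .next k s s' hs hs'⟩
    obtain ⟨s, hs⟩ := this (2 * numLeaves w C (fun _ => none) - 1 + 1)
    have := (add_remaining_of_run hs).1
    omega
  · have := (add_remaining_of_run h).1
    omega

/-! ### The antichain of the leaves -/

/-- The minimal covers, and the maximal feasible sets with an additional element, as a family of
subsets of a set with `n + 1` elements. -/
def leafFamily (w : Fin n → ℕ) (C : ℕ) : Finset (Finset (Option (Fin n))) :=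
  (minCovers w C).image (fun A => A.map Function.Embedding.some) ∪
    (maxFeasible w C).image (fun B => insertNone B)

theorem mem_leafFamily {X : Finset (Option (Fin n))} : X ∈ leafFamily w C ↔
    (∃ A ∈ minCovers w C, A.map Function.Embedding.some = X) ∨
      ∃ B ∈ maxFeasible w C, insertNone B = X := by
  simp [leafFamily]

theorem card_leafFamily (w : Fin n → ℕ) (C : ℕ) :
    #(leafFamily w C) = numLeaves w C fun _ => none := by
  classical
  rw [leafFamily, card_union_of_disjoint, card_image_of_injective _ (map_injective _),
    card_image_of_injective _ insertNone.injective]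
  · simp [numLeaves, numCompat, Compat]
  · refine disjoint_left.2 fun X hX hX' => ?_
    obtain ⟨A, -, rfl⟩ := mem_image.1 hX
    obtain ⟨B, -, h⟩ := mem_image.1 hX'
    have := h ▸ none_mem_insertNone (s := B)
    simp at this

/-- A cover never lies in a feasible set; the extra element `none` rules out the opposite inclusion.
-/
theorem isAntichain_leafFamily (w : Fin n → ℕ) (C : ℕ) :
    IsAntichain (· ⊆ ·) (leafFamily w C : Set (Finset (Option (Fin n)))) := by
  intro X hX Y hY hne hXY
  rcases mem_leafFamily.1 hX with ⟨A, hA, rfl⟩ | ⟨A, hA, rfl⟩ <;>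
    rcases mem_leafFamily.1 hY with ⟨B, hB, rfl⟩ | ⟨B, hB, rfl⟩
  · exact hne (congrArg _ (minCovers_eq_of_subset (sum_lt_of_mem_minCovers hA) hB
      (map_subset_map.1 hXY)))
  · have hAB : A ⊆ B := fun a ha =>
      some_mem_insertNone.1 (hXY (mem_map_of_mem Function.Embedding.some ha))
    have := sum_lt_of_mem_minCovers hA
    have := sum_le_of_mem_maxFeasible hB
    have := sum_le_sum_of_subset (f := w) hAB
    omega
  · simpa using hXY (none_mem_insertNone (s := A))
  · exact hne (congrArg _ (maxFeasible_eq_of_subset hA (sum_le_of_mem_maxFeasible hB)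
      (insertNone.le_iff_le.1 hXY)))

/-- When all sets of size at least `t` are covers, the sets of the family have size at most `t`. -/
theorem card_le_of_mem_leafFamily {t : ℕ} (ht0 : 0 < t)
    (ht : ∀ A : Finset (Fin n), t ≤ #A → C < ∑ i ∈ A, w i) {X : Finset (Option (Fin n))}
    (hX : X ∈ leafFamily w C) : #X ≤ t := by
  rcases mem_leafFamily.1 hX with ⟨A, hA, rfl⟩ | ⟨A, hA, rfl⟩
  · rw [card_map]
    by_contra! hlt
    obtain ⟨a, ha⟩ : A.Nonempty := card_pos.1 (by omega)
    have := ht (A.erase a) (by rw [card_erase_of_mem ha]; omega)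
    have := (mem_filter.1 hA).2.2 a ha
    have := add_sum_erase A w ha
    omega
  · rw [card_insertNone]
    by_contra! hlt
    have := ht A (by omega)
    have := sum_le_of_mem_maxFeasible hA
    omega

theorem numLeaves_le_choose {t : ℕ} (ht0 : 0 < t)
    (ht : ∀ A : Finset (Fin n), t ≤ #A → C < ∑ i ∈ A, w i) (hn : t ≤ n) (htn : t ≤ n / 2 + 1) :
    numLeaves w C (fun _ => none) ≤ (n + 1).choose t := by
  have := card_le_choose_of_antichain (isAntichain_leafFamily w C)
    (fun X hX => card_le_of_mem_leafFamily ht0 ht hX) (by simp; omega) (by simp; omega)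
  rwa [card_leafFamily, Fintype.card_option, Fintype.card_fin] at this

theorem numLeaves_le_choose_sub {t : ℕ}
    (ht : ∀ A : Finset (Fin n), t ≤ #A → C < ∑ i ∈ A, w i) {K : Finset (Fin n)}
    (hK : #K + 1 = t) (hKC : ∑ i ∈ K, w i ≤ C) :
    numLeaves w C (fun _ => none) ≤
      (n + 1).choose (n / 2 + 1) - t.choose (n / 2 + 1) + 1 := by
  have hKmem : insertNone K ∈ leafFamily w C := by
    refine mem_leafFamily.2 (.inr ⟨K, mem_filter.2 ⟨mem_univ _, hKC, fun a ha => ?_⟩, rfl⟩)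
    have := ht (insert a K) (by rw [card_insert_of_notMem ha]; omega)
    rwa [sum_insert ha, add_comm] at this
  have hanti := isAntichain_leafFamily w C
  have := card_le_of_antichain_not_subset (K := insertNone K) (h := n / 2 + 1)
    (𝒜 := (leafFamily w C).erase (insertNone K))
    (hanti.subset (by simp)) (fun A hA hAK => ?_) (by omega) (by simp; omega) (by simp; omega)
  · rw [card_insertNone, hK, Fintype.card_option, Fintype.card_fin, card_erase_of_mem hKmem,
      card_leafFamily] at this
    omega
  · obtain ⟨hne, hA⟩ := mem_erase.1 hA
    exact hanti hA hKmem hne hAK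

/-! ### The lightest variables -/

theorem card_filter_sub_le {k : ℕ} (hk : k ≤ n) : #{i : Fin n | n - k ≤ i.val} = k := by
  have h := card_filter_add_card_filter_not (s := (univ : Finset (Fin n))) fun i => i.val < n - k
  simp only [not_lt, card_univ, Fintype.card_fin] at h
  have : #{i : Fin n | i.val < n - k} = n - k := by
    rw [Fin.card_filter_val_lt]
    omega
  omega

/-- The last `k` values of an antitone function have the least sum among all sets of `k` values. -/
theorem sum_filter_sub_le_of_antitone {v : Fin n → ℕ} (hv : Antitone v) {A : Finset (Fin n)} {k : ℕ}
    (hk : k ≤ #A) : ∑ i with n - k ≤ i.val, v i ≤ ∑ i ∈ A, v i := by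
  have hkn : k ≤ n := hk.trans (card_finset_fin_le A)
  set T : Finset (Fin n) := {i | n - k ≤ i.val} with hT
  have hTcard : #T = k := card_filter_sub_le hkn
  have hcard : #(T \ A) ≤ #(A \ T) := by
    have := card_sdiff_add_card_inter T A
    have := card_sdiff_add_card_inter A T
    rw [inter_comm] at this
    omega
  -- Indices outside `T` precede those in `T`, so the maximum of `v` on `T \ A` is a lower bound for
  -- `v` on `A \ T`.
  have hsum : ∑ i ∈ T \ A, v i ≤ ∑ i ∈ A \ T, v i := by
    rcases (T \ A).eq_empty_or_nonempty with he | hne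
    · simp [he]
    obtain ⟨m, hm, hmax⟩ := exists_max_image _ v hne
    calc ∑ i ∈ T \ A, v i ≤ #(T \ A) • v m := sum_le_card_nsmul _ _ _ hmax
      _ ≤ #(A \ T) • v m := nsmul_le_nsmul_left zero_le hcard
      _ ≤ ∑ i ∈ A \ T, v i := card_nsmul_le_sum _ _ _ fun i hi => hv (Fin.le_def.2 (by
          simp only [hT, mem_sdiff, mem_filter, mem_univ, true_and] at hi hm
          omega))
  have h1 := sum_inter_add_sum_sdiff T A v
  have h2 := sum_inter_add_sum_sdiff A T v
  rw [inter_comm] at h2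
  omega

end MBnB

theorem mainTheorem1 (n : ℕ) (w : Fin n → ℕ) (hw : ∀ i, 0 < w i) (C : ℕ) (hC : 0 < C)
    (σ : Equiv.Perm (Fin n)) (hσ : Antitone fun i => w (σ i))
    (t : ℕ)
    (ht : IsLeast {k : ℕ | 1 ≤ k ∧ k ≤ n ∧
      C < ∑ i ∈ (Finset.univ : Finset (Fin n)).filter (fun i => n - k ≤ i.val), w (σ i)} t) :
    ∃ S : ℕ,
      MBnB.IsComplexity w C S ∧
      (∃ T, MBnB.IsMBnBTree w C T) ∧
      (∀ T, MBnB.IsMBnBTree w C T → T.numNodes = S) ∧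
      (t ≤ n / 2 + 1 → (S : ℤ) ≤ 2 * ((n + 1).choose t : ℤ) - 1) ∧
      (n / 2 + 1 < t →
        (S : ℤ) ≤ 2 * (((n + 1).choose (n / 2 + 1) : ℤ) - (t.choose (n / 2 + 1) : ℤ)) + 1) := by
  obtain ⟨⟨ht1, htn, htC⟩, hmin⟩ := ht
  have hcover : ∀ A : Finset (Fin n), t ≤ A.card → C < ∑ i ∈ A, w i := fun A hA => by
    have := MBnB.sum_filter_sub_le_of_antitone hσ (A := A.map σ.symm.toEmbedding) (k := t)
      (by rwa [Finset.card_map])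
    rw [Finset.sum_map] at this
    simp only [Equiv.coe_toEmbedding, Equiv.apply_symm_apply] at this
    exact htC.trans_le this
  have hpos := MBnB.numLeaves_pos (MBnB.reachable_root w C)
  refine ⟨_, MBnB.isComplexity w C, MBnB.exists_isTreeFrom w C _, fun T hT => ?_, fun h => ?_,
    fun h => ?_⟩
  · have := MBnB.numNodes_add_one hT (MBnB.reachable_root w C)
    omega
  · have := MBnB.numLeaves_le_choose ht1 hcover htn h
    omega
  -- Here `t ≥ 2`, so `t - 1` is an admissible index and minimality of `t` applies to it.
  · have hle : ∑ i ∈ (Finset.univ : Finset (Fin n)).filter (fun i => n - (t - 1) ≤ i.val),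
        w (σ i) ≤ C := by
      by_contra! hlt
      have := hmin ⟨by omega, by omega, hlt⟩
      omega
    have := MBnB.numLeaves_le_choose_sub hcover
      (K := ((Finset.univ : Finset (Fin n)).filter fun i => n - (t - 1) ≤ i.val).map
        σ.toEmbedding)
      (by rw [Finset.card_map, MBnB.card_filter_sub_le (by omega)]; omega)
      (by simpa [Finset.sum_map] using hle)
    -- This makes the natural subtraction in `numLeaves_le_choose_sub` agree with the integer one in
    -- the goal.
    have := Nat.choose_mono (n / 2 + 1) (show t ≤ n + 1 by omega)
    simp only at this
    omega
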